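/- Let $\mathbb K=\mathbb R$ or $\mathbb C$, and let $\alpha=(\alpha_n)_{n\in\mathbb N}$ and $\beta=(\beta_n)_{n\in\mathbb N}$ be (not necessarily strictly) increasing sequences of real numbers tending to infinity. The power series space of finite type $\Lambda_0(\alpha)$ consists of all scalar sequences $x=(x_n)_{n\in\mathbb N}$ in $\mathbb K$ with $\|x\|_k=\sum_{n}|x_n|e^{-\alpha_n/k}<\infty$ for all $k=1,2,\dots$, and the power series space of infinite type $\Lambda_\infty(\alpha)$ of all $x$ with $\|x\|_k=\sum_{n}|x_n|e^{k\alpha_n}<\infty$ for all $k=1,2,\dots$; both are graded by these norms, and a Cartesian product $E\times F$ of graded spaces is graded by $\|(x,y)\|_k=\|x\|_k+\|y\|_k$. A linear operator $T:E\to E$ on a graded space is continuous if for every $k$ there are $m$ and $C>0$ with $\|Tx\|_k\le C\|x\|_m$ for all $x\in E$; put $\pi_T(k)=\inf\{r\in\mathbb N:\ \sup_{\|x\|_r\le 1}\|Tx\|_k<\infty\}$. The space $E$ is called tame if there is a non-decreasing function $S:\mathbb N\to\mathbb N$ such that every continuous linear operator $T:E\to E$ satisfies $\pi_T(k)\le S(k)$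 for all sufficiently large $k$ (how large may depend on $T$). A finite limit point of a double sequence $(\beta_i/\alpha_j)_{i,j\in\mathbb N}$ is a real number $t$ each neighbourhood of which contains $\beta_i/\alpha_j$ for infinitely many pairs $(i,j)$; the pairs with $\alpha_j=0$, if any, are left out. Then: 1. $\Lambda_0(\alpha)\times\Lambda_0(\beta)$ is always tame. 2. $\Lambda_0(\alpha)\times\Lambda_\infty(\beta)$ is tame if and only if the set of finite limit points of $(\beta_i/\beta_j)_{i,j\in\mathbb N}$ and the set of finite limit points of $(\alpha_i/\beta_j)_{i,j\in\mathbb N}$ are both bounded. 3. $\Lambda_\infty(\alpha)\times\Lambda_\infty(\beta)$ is tame if and only if the sets of finite limit points of $(\beta_i/\beta_j)_{i,j\in\mathbb N}$, $(\alpha_i/\alpha_j)_{i,j\in\mathbb N}$, $(\beta_i/\alpha_j)_{i,j\in\mathbb N}$ and $(\alpha_i/\beta_j)_{i,j\in\mathbb N}$ are all bounded. -/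

import Mathlib

open scoped ENNReal

noncomputable section

namespace PowerSeries10

/-! ### Tameness of pairs of graded spaces

A graded space is a vector space with a sequence of seminorms. -/

section Tame

variable {𝕜 E F : Type*} [RCLike 𝕜] [AddCommGroup E] [Module 𝕜 E] [AddCommGroup F] [Module 𝕜 F]

/-- Continuity of a linear map between graded spaces:
for every `k` there are `m` and `C > 0` with `‖T x‖_k ≤ C ‖x‖_m` for all `x`. -/
def IsContinuousOp (p : ℕ → Seminorm 𝕜 E) (q : ℕ → Seminorm 𝕜 F) (T : E →ₗ[𝕜] F) : Prop :=
  ∀ k : ℕ, ∃ m : ℕ, ∃ C : ℝ, 0 < C ∧ ∀ x : E, q k (T x) ≤ C * p m x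

/-- `‖T‖_{k,r} = sup {‖T x‖_k : ‖x‖_r ≤ 1}`, possibly infinite. -/
def opNorm (p : ℕ → Seminorm 𝕜 E) (q : ℕ → Seminorm 𝕜 F) (T : E →ₗ[𝕜] F) (k r : ℕ) : ℝ≥0∞ :=
  ⨆ (x : E) (_ : p r x ≤ 1), ENNReal.ofReal (q k (T x))

/-- The characteristic of continuity `π_T(k) = inf {r : ‖T‖_{k,r} < ∞}`
(the infimum of the empty set being `∞`). -/
def charCont (p : ℕ → Seminorm 𝕜 E) (q : ℕ → Seminorm 𝕜 F) (T : E →ₗ[𝕜] F) (k : ℕ) : ℕ∞ :=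
  ⨅ (r : ℕ) (_ : opNorm p q T k r < ∞), (r : ℕ∞)

/-- The pair `(E, F)` is tame: one nondecreasing `S` satisfies, for every continuous linear
`T : E → F`, the inequality `π_T(k) ≤ S(k)` for all sufficiently large `k`. -/
def TamePair (p : ℕ → Seminorm 𝕜 E) (q : ℕ → Seminorm 𝕜 F) : Prop :=
  ∃ S : ℕ → ℕ, Monotone S ∧ ∀ T : E →ₗ[𝕜] F, IsContinuousOp p q T →
    ∃ k₀ : ℕ, ∀ k ≥ k₀, charCont p q T k ≤ (S k : ℕ∞)

/-- The graded space `E` is tame. -/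
def IsTame (p : ℕ → Seminorm 𝕜 E) : Prop := TamePair p p

/-- The product grading `‖(x, y)‖_k = ‖x‖_k + ‖y‖_k` on `E × F`. -/
def prodGrading (p : ℕ → Seminorm 𝕜 E) (q : ℕ → Seminorm 𝕜 F) : ℕ → Seminorm 𝕜 (E × F) :=
  fun k => (p k).comp (LinearMap.fst 𝕜 E F) + (q k).comp (LinearMap.snd 𝕜 E F)

end Tame

/-! ### Power series spaces -/

section Spaces

variable (𝕜 : Type*) [RCLike 𝕜]

/-- The space of all sequences `x` with `∑ n, |x n| * exp (r k * α n) < ∞` for every `k`. -/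
def weightedSpace (r : ℕ → ℝ) (α : ℕ → ℝ) : Submodule 𝕜 (ℕ → 𝕜) where
  carrier := {x | ∀ k, Summable fun n => ‖x n‖ * Real.exp (r k * α n)}
  zero_mem' := by
    intro k
    simpa using (summable_zero : Summable fun _ : ℕ => (0 : ℝ))
  add_mem' := by
    intro x y hx hy k
    refine Summable.of_nonneg_of_le (fun n => by positivity) (fun n => ?_) ((hx k).add (hy k))
    rw [← add_mul]
    exact mul_le_mul_of_nonneg_right (norm_add_le _ _) (Real.exp_pos _).le
  smul_mem' := by
    intro c x hx k
    simpa [mul_assoc] using (hx k).mul_left ‖c‖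

/-- The grading `‖x‖_k = ∑ n, |x n| * exp (r k * α n)` of `weightedSpace 𝕜 r α`. -/
def weightedGrading (r : ℕ → ℝ) (α : ℕ → ℝ) (k : ℕ) : Seminorm 𝕜 (weightedSpace 𝕜 r α) :=
  Seminorm.of (fun x => ∑' n, ‖x.1 n‖ * Real.exp (r k * α n))
    (by
      intro x y
      rw [← (x.2 k).tsum_add (y.2 k)]
      refine Summable.tsum_le_tsum (fun n => ?_) ((x + y).2 k) ((x.2 k).add (y.2 k))
      rw [← add_mul]
      exact mul_le_mul_of_nonneg_right (norm_add_le _ _) (Real.exp_pos _).le)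
    (by
      intro c x
      rw [← tsum_mul_left]
      simp [mul_assoc])

/-- Exponents for finite type: the `k`-th one is `-1/(k+1)`, so that index `k = 0, 1, 2, …`
here is index `k + 1` in the numbering that starts at `1`. -/
def finiteExp (k : ℕ) : ℝ := -(1 / ((k : ℝ) + 1))

/-- Exponents for infinite type: the `k`-th one is `k + 1`. -/
def infiniteExp (k : ℕ) : ℝ := (k : ℝ) + 1

/-- The power series space of finite type `Λ₀(α)`. -/
abbrev FiniteSpace (α : ℕ → ℝ) : Submodule 𝕜 (ℕ → 𝕜) := weightedSpace 𝕜 finiteExp α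

/-- Its grading `‖x‖_k = ∑ n, |x n| * exp (-(1/(k+1)) * α n)`. -/
abbrev finiteGrading (α : ℕ → ℝ) : ℕ → Seminorm 𝕜 (FiniteSpace 𝕜 α) :=
  weightedGrading 𝕜 finiteExp α

/-- The power series space of infinite type `Λ_∞(α)`. -/
abbrev InfiniteSpace (α : ℕ → ℝ) : Submodule 𝕜 (ℕ → 𝕜) := weightedSpace 𝕜 infiniteExp α

/-- Its grading `‖x‖_k = ∑ n, |x n| * exp ((k+1) * α n)`. -/
abbrev infiniteGrading (α : ℕ → ℝ) : ℕ → Seminorm 𝕜 (InfiniteSpace 𝕜 α) :=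
  weightedGrading 𝕜 infiniteExp α

end Spaces

/-- The finite limit points of the double sequence `(β i / α j)`: the reals `t` each of whose
neighbourhoods contains `β i / α j` for infinitely many index pairs `(i, j)`. Pairs with
`α j = 0`, for which the quotient is undefined, are left out. -/
def finiteLimitPoints (β α : ℕ → ℝ) : Set ℝ :=
  {t | ∀ ε > 0, {ij : ℕ × ℕ | α ij.2 ≠ 0 ∧ |β ij.1 / α ij.2 - t| < ε}.Infinite}

end PowerSeries10

end

namespace PowerSeries10

/-! ### Tameness in terms of estimates -/

section Tame

variable {𝕜 E F G : Type*} [RCLike 𝕜] [AddCommGroup E] [Module 𝕜 E] [AddCommGroup F] [Module 𝕜 F]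
  [AddCommGroup G] [Module 𝕜 G]

/-! An operator on a product is a 2×2 matrix of operators, so the product is tame exactly when the
four pairs formed from its factors are (`isTame_prodGrading_iff`). Everything then depends on the
type of the source, and operators may be tested on unit vectors `e_j`
(`IsContinuousOp.bound_of_unitVector`).

Source of finite type: `T e_j` decays like `exp (-α j / (m + 1))` in the lowest norm and stays
bounded in every other. Interpolation gives decay in the norm `k` at the rate `t / (m + 1)`, where
`t` depends on `k` alone. For `k > m` this rate is at least `t / k`, which no longer involves `T`.
Hence such pairs are always tame (`tamePair_finiteGrading`).

Source of infinite type: tameness means bounded finite limit points of `β i / α j`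
(`tamePair_infiniteGrading_iff`). If they are bounded, the quotients avoid, for large `j`, a long
interval `[M, N]`; the lowest norm controls coordinates below the gap and the norm `k + 1` those
above it. If they are unbounded, a weighted partial permutation along pairs with large quotients
defeats any given `S`. -/

/-- The seminorms increase up to multiplicative constants. -/
def EssentiallyIncreasing (p : ℕ → Seminorm 𝕜 E) : Prop :=
  ∀ k l : ℕ, k ≤ l → ∃ C : ℝ, 0 < C ∧ ∀ x, p k x ≤ C * p l x

theorem opNorm_lt_top_iff (p : ℕ → Seminorm 𝕜 E) (q : ℕ → Seminorm 𝕜 F) (T : E →ₗ[𝕜] F)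
    (k r : ℕ) : opNorm p q T k r < ∞ ↔ ∃ C : ℝ, 0 < C ∧ ∀ x, q k (T x) ≤ C * p r x := by
  constructor
  · intro h
    set D : ℝ := (opNorm p q T k r).toReal with hD
    have hD0 : 0 ≤ D := ENNReal.toReal_nonneg
    have key : ∀ x, p r x ≤ 1 → q k (T x) ≤ D := by
      intro x hx
      have h1 : ENNReal.ofReal (q k (T x)) ≤ opNorm p q T k r :=
        le_iSup₂ (f := fun (x : E) (_ : p r x ≤ 1) => ENNReal.ofReal (q k (T x))) x hx
      exact (ENNReal.ofReal_le_iff_le_toReal h.ne).1 h1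
    have scale : ∀ (x : E) (c : ℝ), 0 ≤ c → c * p r x ≤ 1 → c * q k (T x) ≤ D := by
      intro x c hc hx
      have h1 := key ((c : 𝕜) • x) (by rwa [map_smul_eq_mul, RCLike.norm_ofReal, abs_of_nonneg hc])
      rwa [map_smul, map_smul_eq_mul, RCLike.norm_ofReal, abs_of_nonneg hc] at h1
    refine ⟨D + 1, by linarith, fun x => ?_⟩
    -- On the kernel of `p r` every multiple of `x` lies in the unit ball, which forces `q k (T x)`
    -- to vanish.
    rcases (apply_nonneg (p r) x).eq_or_lt with h0 | h0
    · rw [← h0, mul_zero]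
      by_contra! hq
      have h1 := scale x ((D + 1) / q k (T x)) (by positivity) (by rw [← h0]; simp)
      rw [div_mul_cancel₀ _ hq.ne'] at h1
      linarith
    · have h1 := scale x (p r x)⁻¹ (by positivity) (inv_mul_cancel₀ h0.ne').le
      rw [inv_mul_le_iff₀ h0] at h1
      nlinarith
  · rintro ⟨C, hC, h⟩
    refine lt_of_le_of_lt ?_ (ENNReal.ofReal_lt_top (r := C))
    refine iSup₂_le fun x hx => ENNReal.ofReal_le_ofReal ?_
    exact (h x).trans (by nlinarith)

theorem charCont_le_iff {p : ℕ → Seminorm 𝕜 E} (hp : EssentiallyIncreasing p)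
    (q : ℕ → Seminorm 𝕜 F) (T : E →ₗ[𝕜] F) (k n : ℕ) :
    charCont p q T k ≤ (n : ℕ∞) ↔ ∃ C : ℝ, 0 < C ∧ ∀ x, q k (T x) ≤ C * p n x := by
  constructor
  · intro h
    have h1 : charCont p q T k < ((n + 1 : ℕ) : ℕ∞) :=
      h.trans_lt (by exact_mod_cast Nat.lt_succ_self n)
    obtain ⟨r, hr⟩ := iInf_lt_iff.1 h1
    obtain ⟨hr1, hr2⟩ := iInf_lt_iff.1 hr
    have hrn : r ≤ n := Nat.lt_succ_iff.1 (by exact_mod_cast hr2)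
    obtain ⟨C, hC, hT⟩ := (opNorm_lt_top_iff p q T k r).1 hr1
    obtain ⟨D, hD, hpD⟩ := hp r n hrn
    refine ⟨C * D, by positivity, fun x => (hT x).trans ?_⟩
    rw [mul_assoc]
    exact mul_le_mul_of_nonneg_left (hpD x) hC.le
  · intro h
    exact iInf₂_le n ((opNorm_lt_top_iff p q T k n).2 h)

theorem tamePair_iff {p : ℕ → Seminorm 𝕜 E} (hp : EssentiallyIncreasing p)
    (q : ℕ → Seminorm 𝕜 F) :
    TamePair p q ↔ ∃ S : ℕ → ℕ, Monotone S ∧ ∀ T : E →ₗ[𝕜] F, IsContinuousOp p q T →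
      ∃ k₀ : ℕ, ∀ k ≥ k₀, ∃ C : ℝ, 0 < C ∧ ∀ x, q k (T x) ≤ C * p (S k) x := by
  simp only [TamePair, charCont_le_iff hp]

theorem EssentiallyIncreasing.prod {p : ℕ → Seminorm 𝕜 E} {q : ℕ → Seminorm 𝕜 F}
    (hp : EssentiallyIncreasing p) (hq : EssentiallyIncreasing q) :
    EssentiallyIncreasing (prodGrading p q) := by
  intro k l hkl
  obtain ⟨C, hC, h1⟩ := hp k l hkl
  obtain ⟨D, hD, h2⟩ := hq k l hkl
  refine ⟨C + D, by positivity, fun x => ?_⟩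
  have h3 := apply_nonneg (p l) x.1
  have h4 := apply_nonneg (q l) x.2
  have h5 := h1 x.1
  have h6 := h2 x.2
  change p k x.1 + q k x.2 ≤ (C + D) * (p l x.1 + q l x.2)
  nlinarith [mul_nonneg hC.le h4, mul_nonneg hD.le h3]

/-- Tameness of a graded space passes to pairs consisting of a retract and a subspace. -/
theorem IsTame.tamePair_of_retract {P : ℕ → Seminorm 𝕜 G} {p : ℕ → Seminorm 𝕜 E}
    {q : ℕ → Seminorm 𝕜 F} (hP : EssentiallyIncreasing P) (hp : EssentiallyIncreasing p)
    (i : E →ₗ[𝕜] G) (v : G →ₗ[𝕜] E) (w : F →ₗ[𝕜] G) (hvi : ∀ x, v (i x) = x)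
    (hi : ∀ k x, P k (i x) = p k x) (hv : ∀ k z, p k (v z) ≤ P k z)
    (hw : ∀ k y, P k (w y) = q k y) (h : IsTame P) : TamePair p q := by
  obtain ⟨S, hS, hT⟩ := (tamePair_iff hP P).1 h
  refine (tamePair_iff hp q).2 ⟨S, hS, fun T hTc => ?_⟩
  obtain ⟨k₀, hk₀⟩ := hT (w ∘ₗ T ∘ₗ v) (by
    intro k
    obtain ⟨m, C, hC, hm⟩ := hTc k
    refine ⟨m, C, hC, fun z => ?_⟩
    simp only [LinearMap.comp_apply, hw]
    exact (hm _).trans (mul_le_mul_of_nonneg_left (hv m z) hC.le))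
  refine ⟨k₀, fun k hk => ?_⟩
  obtain ⟨C, hC, hb⟩ := hk₀ k hk
  refine ⟨C, hC, fun x => ?_⟩
  have h1 := hb (i x)
  simpa only [LinearMap.comp_apply, hw, hvi, hi] using h1

/-- Each factor is a retract of the product, which gives one direction. For the other, the sum of
the functions `S` of the four blocks serves the whole matrix. -/
theorem isTame_prodGrading_iff {p : ℕ → Seminorm 𝕜 E} {q : ℕ → Seminorm 𝕜 F}
    (hp : EssentiallyIncreasing p) (hq : EssentiallyIncreasing q) :
    IsTame (prodGrading p q) ↔
      TamePair p p ∧ TamePair p q ∧ TamePair q p ∧ TamePair q q := by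
  have hP := hp.prod hq
  have hval : ∀ k (z : E × F), prodGrading p q k z = p k z.1 + q k z.2 := fun _ _ => rfl
  constructor
  · intro h
    have hl : ∀ k (x : E), prodGrading p q k (LinearMap.inl 𝕜 E F x) = p k x := by
      simp [hval]
    have hr : ∀ k (y : F), prodGrading p q k (LinearMap.inr 𝕜 E F y) = q k y := by
      simp [hval]
    have hl' : ∀ k (z : E × F), p k (LinearMap.fst 𝕜 E F z) ≤ prodGrading p q k z := by
      intro k z
      simp [hval]
    have hr' : ∀ k (z : E × F), q k (LinearMap.snd 𝕜 E F z) ≤ prodGrading p q k z := by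
      intro k z
      simp [hval]
    exact ⟨h.tamePair_of_retract hP hp _ _ _ (fun _ => rfl) hl hl' hl,
      h.tamePair_of_retract hP hp _ _ _ (fun _ => rfl) hl hl' hr,
      h.tamePair_of_retract hP hq _ _ _ (fun _ => rfl) hr hr' hl,
      h.tamePair_of_retract hP hq _ _ _ (fun _ => rfl) hr hr' hr⟩
  · rintro ⟨h1, h2, h3, h4⟩
    obtain ⟨S₁, hS₁, h1⟩ := (tamePair_iff hp p).1 h1
    obtain ⟨S₂, hS₂, h2⟩ := (tamePair_iff hp q).1 h2
    obtain ⟨S₃, hS₃, h3⟩ := (tamePair_iff hq p).1 h3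
    obtain ⟨S₄, hS₄, h4⟩ := (tamePair_iff hq q).1 h4
    refine (tamePair_iff hP _).2 ⟨fun k => S₁ k + S₂ k + S₃ k + S₄ k,
      ((hS₁.add hS₂).add hS₃).add hS₄, fun T hT => ?_⟩
    have cont : ∀ k, ∃ m : ℕ, ∃ C : ℝ, 0 < C ∧ ∀ z : E × F,
        p k (T z).1 + q k (T z).2 ≤ C * (p m z.1 + q m z.2) := hT
    obtain ⟨k₁, h1⟩ := h1 (LinearMap.fst 𝕜 E F ∘ₗ T ∘ₗ LinearMap.inl 𝕜 E F) (by
      intro k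
      obtain ⟨m, C, hC, h⟩ := cont k
      refine ⟨m, C, hC, fun x => ?_⟩
      have := h (x, 0)
      simp only [map_zero, add_zero] at this
      exact (le_add_of_nonneg_right (apply_nonneg _ _)).trans this)
    obtain ⟨k₂, h2⟩ := h2 (LinearMap.snd 𝕜 E F ∘ₗ T ∘ₗ LinearMap.inl 𝕜 E F) (by
      intro k
      obtain ⟨m, C, hC, h⟩ := cont k
      refine ⟨m, C, hC, fun x => ?_⟩
      have := h (x, 0)
      simp only [map_zero, add_zero] at this
      exact (le_add_of_nonneg_left (apply_nonneg _ _)).trans this)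
    obtain ⟨k₃, h3⟩ := h3 (LinearMap.fst 𝕜 E F ∘ₗ T ∘ₗ LinearMap.inr 𝕜 E F) (by
      intro k
      obtain ⟨m, C, hC, h⟩ := cont k
      refine ⟨m, C, hC, fun x => ?_⟩
      have := h (0, x)
      simp only [map_zero, zero_add] at this
      exact (le_add_of_nonneg_right (apply_nonneg _ _)).trans this)
    obtain ⟨k₄, h4⟩ := h4 (LinearMap.snd 𝕜 E F ∘ₗ T ∘ₗ LinearMap.inr 𝕜 E F) (by
      intro k
      obtain ⟨m, C, hC, h⟩ := cont k
      refine ⟨m, C, hC, fun x => ?_⟩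
      have := h (0, x)
      simp only [map_zero, zero_add] at this
      exact (le_add_of_nonneg_left (apply_nonneg _ _)).trans this)
    refine ⟨k₁ + k₂ + k₃ + k₄, fun k hk => ?_⟩
    obtain ⟨C₁, hC₁, h1⟩ := h1 k (by omega)
    obtain ⟨C₂, hC₂, h2⟩ := h2 k (by omega)
    obtain ⟨C₃, hC₃, h3⟩ := h3 k (by omega)
    obtain ⟨C₄, hC₄, h4⟩ := h4 k (by omega)
    obtain ⟨D₁, hD₁, g1⟩ := hp (S₁ k) (S₁ k + S₂ k + S₃ k + S₄ k) (by omega)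
    obtain ⟨D₂, hD₂, g2⟩ := hp (S₂ k) (S₁ k + S₂ k + S₃ k + S₄ k) (by omega)
    obtain ⟨D₃, hD₃, g3⟩ := hq (S₃ k) (S₁ k + S₂ k + S₃ k + S₄ k) (by omega)
    obtain ⟨D₄, hD₄, g4⟩ := hq (S₄ k) (S₁ k + S₂ k + S₃ k + S₄ k) (by omega)
    refine ⟨C₁ * D₁ + C₂ * D₂ + C₃ * D₃ + C₄ * D₄, by positivity, fun z => ?_⟩
    have e : T z = T (z.1, 0) + T (0, z.2) := by rw [← map_add]; simp
    have a1 := (h1 z.1).trans (mul_le_mul_of_nonneg_left (g1 z.1) hC₁.le)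
    have a2 := (h2 z.1).trans (mul_le_mul_of_nonneg_left (g2 z.1) hC₂.le)
    have a3 := (h3 z.2).trans (mul_le_mul_of_nonneg_left (g3 z.2) hC₃.le)
    have a4 := (h4 z.2).trans (mul_le_mul_of_nonneg_left (g4 z.2) hC₄.le)
    have b1 := map_add_le_add (p k) (T (z.1, 0)).1 (T (0, z.2)).1
    have b2 := map_add_le_add (q k) (T (z.1, 0)).2 (T (0, z.2)).2
    have c1 := apply_nonneg (p (S₁ k + S₂ k + S₃ k + S₄ k)) z.1
    have c2 := apply_nonneg (q (S₁ k + S₂ k + S₃ k + S₄ k)) z.2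
    simp only [LinearMap.comp_apply, LinearMap.fst_apply, LinearMap.snd_apply,
      LinearMap.inl_apply, LinearMap.inr_apply] at a1 a2 a3 a4
    simp only [hval]
    rw [e, Prod.fst_add, Prod.snd_add]
    have d1 : 0 ≤ (C₁ * D₁ + C₂ * D₂) * q (S₁ k + S₂ k + S₃ k + S₄ k) z.2 := by positivity
    have d2 : 0 ≤ (C₃ * D₃ + C₄ * D₄) * p (S₁ k + S₂ k + S₃ k + S₄ k) z.1 := by positivity
    linarith

end Tame

/-! ### Estimates in weighted sequence spaces -/

section Weighted

variable {𝕜 : Type*} [RCLike 𝕜]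

theorem weightedGrading_apply (r α : ℕ → ℝ) (k : ℕ) (x : weightedSpace 𝕜 r α) :
    weightedGrading 𝕜 r α k x = ∑' n, ‖x.1 n‖ * Real.exp (r k * α n) := rfl

theorem exp_mul_le_of_le {u v a A : ℝ} (huv : u ≤ v) (ha : A ≤ a) :
    Real.exp (u * a) ≤ Real.exp (-(v - u) * A) * Real.exp (v * a) := by
  rw [← Real.exp_add]
  exact Real.exp_le_exp.2 (by nlinarith)

theorem exists_le_of_tendsto_atTop {α : ℕ → ℝ} (hα : Filter.Tendsto α Filter.atTop Filter.atTop) :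
    ∃ A, ∀ n, A ≤ α n := by
  obtain ⟨A, hA⟩ := Filter.bddBelow_range_of_tendsto_atTop_atTop hα
  exact ⟨A, fun n => hA ⟨n, rfl⟩⟩

/-- Finitely many `α n` may be negative, so a constant is needed; a lower bound of `α` supplies it.
-/
theorem essentiallyIncreasing_weightedGrading {r α : ℕ → ℝ} (hr : Monotone r)
    (hα : Filter.Tendsto α Filter.atTop Filter.atTop) :
    EssentiallyIncreasing (weightedGrading 𝕜 r α) := by
  obtain ⟨A, hA⟩ := exists_le_of_tendsto_atTop hα
  intro k l hkl
  refine ⟨Real.exp (-(r l - r k) * A), Real.exp_pos _, fun x => ?_⟩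
  simp only [weightedGrading_apply]
  rw [← tsum_mul_left]
  refine Summable.tsum_le_tsum (fun n => ?_) (x.2 k) ((x.2 l).mul_left _)
  rw [mul_left_comm]
  exact mul_le_mul_of_nonneg_left (exp_mul_le_of_le (hr hkl) (hA n)) (norm_nonneg _)

/-- The unit vectors. -/
noncomputable def unitVector (r α : ℕ → ℝ) (j : ℕ) : weightedSpace 𝕜 r α :=
  ⟨Pi.single j 1, fun k => summable_of_ne_finset_zero (s := {j}) fun n hn => by
    rw [Finset.mem_singleton] at hn
    simp [hn]⟩

theorem weightedGrading_unitVector (r α : ℕ → ℝ) (k j : ℕ) :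
    weightedGrading 𝕜 r α k (unitVector r α j) = Real.exp (r k * α j) := by
  rw [weightedGrading_apply, tsum_eq_single j]
  · simp [unitVector]
  · intro n hn
    simp [unitVector, hn]

theorem tendsto_weightedGrading_sub_sum (r α : ℕ → ℝ) (m : ℕ) (x : weightedSpace 𝕜 r α) :
    Filter.Tendsto (fun N => weightedGrading 𝕜 r α m
      (x - ∑ j ∈ Finset.range N, x.1 j • unitVector r α j)) Filter.atTop (nhds 0) := by
  have h := tendsto_sum_nat_add fun n => ‖x.1 n‖ * Real.exp (r m * α n)
  refine h.congr fun N => ?_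
  have hval : ∀ n, (x - ∑ j ∈ Finset.range N, x.1 j • unitVector r α j).1 n =
      if n < N then 0 else x.1 n := by
    intro n
    have : (∑ j ∈ Finset.range N, x.1 j • unitVector r α j).1 n =
        ∑ j ∈ Finset.range N, x.1 j * (Pi.single j (1 : 𝕜) : ℕ → 𝕜) n := by
      rw [Submodule.coe_sum, Finset.sum_apply]
      rfl
    change x.1 n - (∑ j ∈ Finset.range N, x.1 j • unitVector r α j).1 n = _
    rw [this]
    simp only [Pi.single_apply, mul_ite, mul_one, mul_zero, Finset.sum_ite_eq, Finset.mem_range]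
    split_ifs <;> simp
  have hsplit := Summable.sum_add_tsum_nat_add N
    ((x - ∑ j ∈ Finset.range N, x.1 j • unitVector r α j).2 m)
  rw [weightedGrading_apply, ← hsplit, Finset.sum_eq_zero, zero_add]
  · refine tsum_congr fun n => ?_
    rw [hval, if_neg (by omega)]
  · intro n hn
    rw [hval, if_pos (Finset.mem_range.1 hn)]
    simp

/-- A continuous operator is bounded from one seminorm to another
as soon as its values on the unit vectors are. -/
theorem IsContinuousOp.bound_of_unitVector {F : Type*} [AddCommGroup F] [Module 𝕜 F]
    {r α : ℕ → ℝ} {q : ℕ → Seminorm 𝕜 F} {T : weightedSpace 𝕜 r α →ₗ[𝕜] F}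
    (hT : IsContinuousOp (weightedGrading 𝕜 r α) q T) {k m : ℕ} {C : ℝ}
    (h : ∀ j, q k (T (unitVector r α j)) ≤ C * Real.exp (r m * α j)) (x : weightedSpace 𝕜 r α) :
    q k (T x) ≤ C * weightedGrading 𝕜 r α m x := by
  have hC : 0 ≤ C :=
    nonneg_of_mul_nonneg_left ((apply_nonneg _ _).trans (h 0)) (Real.exp_pos _)
  -- Continuity is used only to let the tail of `x` vanish in the limit; `m'` and `C'` do not enter
  -- the final bound.
  obtain ⟨m', C', hC', hb⟩ := hT k
  have hlim := ((tendsto_weightedGrading_sub_sum r α m' x).const_mul C').const_add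
    (C * weightedGrading 𝕜 r α m x)
  rw [mul_zero, add_zero] at hlim
  refine ge_of_tendsto' hlim fun N => ?_
  set y := ∑ j ∈ Finset.range N, x.1 j • unitVector (𝕜 := 𝕜) r α j with hy
  have h1 : q k (T y) ≤ C * weightedGrading 𝕜 r α m x := by
    rw [hy, map_sum]
    refine (Finset.le_sum_of_subadditive (q k) (map_zero _).le
      (map_add_le_add _) _ _).trans ?_
    rw [weightedGrading_apply, ← tsum_mul_left]
    refine le_trans (Finset.sum_le_sum fun j _ => ?_)
      (((x.2 m).mul_left C).sum_le_tsum (Finset.range N) fun n _ => by positivity)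
    rw [map_smul, map_smul_eq_mul, mul_left_comm]
    exact mul_le_mul_of_nonneg_left (h j) (norm_nonneg _)
  have h2 : T x = T y + T (x - y) := by rw [← map_add, add_sub_cancel]
  rw [h2]
  exact (map_add_le_add (q k) _ _).trans (add_le_add h1 (hb _))

theorem IsContinuousOp.exists_bound_of_eventually {F : Type*} [AddCommGroup F] [Module 𝕜 F]
    {r α : ℕ → ℝ} {q : ℕ → Seminorm 𝕜 F} {T : weightedSpace 𝕜 r α →ₗ[𝕜] F}
    (hT : IsContinuousOp (weightedGrading 𝕜 r α) q T) {k m : ℕ} {C : ℝ}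
    (h : ∀ᶠ j in Filter.atTop, q k (T (unitVector r α j)) ≤ C * Real.exp (r m * α j)) :
    ∃ D, 0 < D ∧ ∀ x, q k (T x) ≤ D * weightedGrading 𝕜 r α m x := by
  obtain ⟨N, hN⟩ := Filter.eventually_atTop.1 h
  set f : ℕ → ℝ := fun j => q k (T (unitVector r α j)) / Real.exp (r m * α j) with hf
  have hf0 : ∀ j, 0 ≤ f j := fun j => by positivity
  have hs : 0 ≤ ∑ j ∈ Finset.range N, f j := Finset.sum_nonneg fun j _ => hf0 j
  refine ⟨|C| + 1 + ∑ j ∈ Finset.range N, f j, by positivity,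
    hT.bound_of_unitVector fun j => ?_⟩
  rw [← div_le_iff₀ (Real.exp_pos _)]
  change f j ≤ _
  rcases lt_or_ge j N with hj | hj
  · have := Finset.single_le_sum (fun i _ => hf0 i) (Finset.mem_range.2 hj)
    have := abs_nonneg C
    linarith
  · have h1 := (div_le_iff₀ (Real.exp_pos _)).2 (hN j hj)
    have := le_abs_self C
    change f j ≤ C at h1
    linarith

/-- Logarithmic convexity of the grading. -/
theorem weightedGrading_le_exp {s β : ℕ → ℝ} {k l m : ℕ} {t a b : ℝ} (ht : 0 ≤ t) (ht' : t ≤ 1)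
    (hk : s k = t * s l + (1 - t) * s m) {y : weightedSpace 𝕜 s β}
    (ha : weightedGrading 𝕜 s β l y ≤ Real.exp a)
    (hb : weightedGrading 𝕜 s β m y ≤ Real.exp b) :
    weightedGrading 𝕜 s β k y ≤ Real.exp (t * a + (1 - t) * b) := by
  set c := t * a + (1 - t) * b with hc
  -- Convexity of `exp`, with shifts `c - a` and `c - b` chosen so that the two sums contribute at
  -- most `t * exp c` and `(1 - t) * exp c`.
  have hpt : ∀ n, ‖y.1 n‖ * Real.exp (s k * β n) ≤
      t * Real.exp (c - a) * (‖y.1 n‖ * Real.exp (s l * β n)) +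
      (1 - t) * Real.exp (c - b) * (‖y.1 n‖ * Real.exp (s m * β n)) := by
    intro n
    have h1 := convexOn_exp.2 (Set.mem_univ (c - a + s l * β n))
      (Set.mem_univ (c - b + s m * β n)) ht (by linarith : 0 ≤ 1 - t) (by ring)
    simp only [smul_eq_mul] at h1
    have h2 : t * (c - a + s l * β n) + (1 - t) * (c - b + s m * β n) = s k * β n := by
      rw [hk, hc]; ring
    rw [h2, Real.exp_add, Real.exp_add] at h1
    have h3 := mul_le_mul_of_nonneg_left h1 (norm_nonneg (y.1 n))
    linarith
  have hsum := Summable.tsum_le_tsum hpt (y.2 k) (((y.2 l).mul_left _).add ((y.2 m).mul_left _))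
  rw [((y.2 l).mul_left _).tsum_add ((y.2 m).mul_left _), tsum_mul_left, tsum_mul_left] at hsum
  have h1 : t * Real.exp (c - a) * weightedGrading 𝕜 s β l y ≤ t * Real.exp c := by
    have := mul_le_mul_of_nonneg_left ha (by positivity : 0 ≤ t * Real.exp (c - a))
    rwa [mul_assoc t _ (Real.exp a), ← Real.exp_add, sub_add_cancel] at this
  have h2 : (1 - t) * Real.exp (c - b) * weightedGrading 𝕜 s β m y ≤ (1 - t) * Real.exp c := by
    have h0 : 0 ≤ 1 - t := by linarith
    have := mul_le_mul_of_nonneg_left hb (by positivity : 0 ≤ (1 - t) * Real.exp (c - b))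
    rwa [mul_assoc (1 - t) _ (Real.exp b), ← Real.exp_add, sub_add_cancel] at this
  rw [weightedGrading_apply] at h1 h2 ⊢
  linarith

theorem strictMono_finiteExp : StrictMono finiteExp := by
  intro a b h
  have h' : (a : ℝ) < b := by exact_mod_cast h
  exact neg_lt_neg (one_div_lt_one_div_of_lt (by positivity) (by linarith))

theorem strictMono_infiniteExp : StrictMono infiniteExp := by
  intro a b h
  have h' : (a : ℝ) < b := by exact_mod_cast h
  simpa [infiniteExp] using h'

/-- Every pair with a power series space of finite type as its source is tame. -/
theorem tamePair_finiteGrading {α s : ℕ → ℝ} (β : ℕ → ℝ)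
    (hα : Filter.Tendsto α Filter.atTop Filter.atTop) (hs : StrictMono s) :
    TamePair (finiteGrading 𝕜 α) (weightedGrading 𝕜 s β) := by
  obtain ⟨A, hA⟩ := exists_le_of_tendsto_atTop hα
  have hinc := essentiallyIncreasing_weightedGrading (𝕜 := 𝕜) strictMono_finiteExp.monotone hα
  -- The weight that writes `s k` as a convex combination of `s 0` and `s (k + 1)`.
  set t : ℕ → ℝ := fun k => (s (k + 1) - s k) / (s (k + 1) - s 0) with ht
  have hden : ∀ k, 0 < s (k + 1) - s 0 := fun k => sub_pos.2 (hs (Nat.succ_pos k))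
  have ht0 : ∀ k, 0 < t k := fun k => div_pos (sub_pos.2 (hs (Nat.lt_succ_self k))) (hden k)
  have ht1 : ∀ k, t k ≤ 1 := fun k => (div_le_one (hden k)).2
    (by have := hs.monotone (Nat.zero_le k); linarith)
  -- Only the last summand is needed; the sum makes the function monotone.
  refine (tamePair_iff hinc _).2 ⟨fun k => ∑ i ∈ Finset.range (k + 1), ⌈(i : ℝ) / t i⌉₊,
    fun a b hab => Finset.sum_le_sum_of_subset (Finset.range_subset_range.2 (by omega)), ?_⟩
  intro T hT
  obtain ⟨m, C, hC, hm⟩ := hT 0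
  refine ⟨m + 1, fun k hk => ?_⟩
  set S : ℕ := ∑ i ∈ Finset.range (k + 1), ⌈(i : ℝ) / t i⌉₊ with hSdef
  have hS : (k : ℝ) / t k ≤ S := by
    refine (Nat.le_ceil _).trans ?_
    exact_mod_cast Finset.single_le_sum (f := fun i : ℕ => ⌈(i : ℝ) / t i⌉₊)
      (fun i _ => Nat.zero_le _) (Finset.self_mem_range_succ k)
  obtain ⟨m', C', hC', hm'⟩ := hT (k + 1)
  have hmS : t k * finiteExp m ≤ finiteExp S := by
    have hk' : (m : ℝ) + 1 ≤ k := by exact_mod_cast hk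
    have h1 : ((m : ℝ) + 1) / t k ≤ S + 1 :=
      (div_le_div_of_nonneg_right hk' (ht0 k).le).trans (by linarith)
    have h2 : 1 / ((S : ℝ) + 1) ≤ 1 / (((m : ℝ) + 1) / t k) :=
      one_div_le_one_div_of_le (div_pos (by positivity) (ht0 k)) h1
    rw [one_div_div] at h2
    simp only [finiteExp]
    have h3 : t k * -(1 / ((m : ℝ) + 1)) = -(t k / (m + 1)) := by ring
    rw [h3]
    linarith
  set B : ℝ := Real.log C' + finiteExp m' * A with hB
  refine hT.exists_bound_of_eventually (C := Real.exp (t k * Real.log C + (1 - t k) * B) *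
    Real.exp (-(finiteExp S - t k * finiteExp m) * A)) (Filter.Eventually.of_forall fun j => ?_)
  have h0 := hm (unitVector finiteExp α j)
  have h0' := hm' (unitVector finiteExp α j)
  rw [weightedGrading_unitVector] at h0 h0'
  have ha : weightedGrading 𝕜 s β 0 (T (unitVector finiteExp α j)) ≤
      Real.exp (Real.log C + finiteExp m * α j) := by
    rwa [Real.exp_add, Real.exp_log hC]
  have hb : weightedGrading 𝕜 s β (k + 1) (T (unitVector finiteExp α j)) ≤ Real.exp B := by
    rw [hB, Real.exp_add, Real.exp_log hC']
    refine h0'.trans (mul_le_mul_of_nonneg_left (Real.exp_le_exp.2 ?_) hC'.le)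
    have : finiteExp m' ≤ 0 := neg_nonpos.2 (by positivity)
    nlinarith [hA j]
  have hconv : s k = t k * s 0 + (1 - t k) * s (k + 1) := by
    have := (hden k).ne'
    simp only [ht]
    field_simp
    ring
  refine (weightedGrading_le_exp (ht0 k).le (ht1 k) hconv ha hb).trans ?_
  have h4 := exp_mul_le_of_le hmS (hA j)
  have h5 : t k * (Real.log C + finiteExp m * α j) + (1 - t k) * B =
      (t k * Real.log C + (1 - t k) * B) + t k * finiteExp m * α j := by ring
  rw [h5, Real.exp_add, mul_assoc (Real.exp _)]
  exact mul_le_mul_of_nonneg_left h4 (Real.exp_pos _).le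

end Weighted

/-! ### Finite limit points of double sequences -/

section LimitPoints

variable {α β : ℕ → ℝ}

/-- A nonzero finite limit point is approached along pairs with both indices large. -/
theorem exists_ge_of_mem_finiteLimitPoints
    (hα : Filter.Tendsto α Filter.atTop Filter.atTop)
    (hβ : Filter.Tendsto β Filter.atTop Filter.atTop) {t ε : ℝ} (ht : t ∈ finiteLimitPoints β α)
    (ht0 : t ≠ 0) (hε : 0 < ε) (N : ℕ) : ∃ i ≥ N, ∃ j ≥ N, |β i / α j - t| < ε := by
  by_contra! H
  have htp : 0 < |t| := abs_pos.2 ht0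
  -- Rows tend to `0` and columns to infinity in absolute value. A neighbourhood of `t` that stays
  -- away from `0` thus meets each of them finitely often.
  set δ := min ε (|t| / 2) with hδ
  have hδ1 : δ ≤ ε := min_le_left _ _
  have hδ2 : δ ≤ |t| / 2 := min_le_right _ _
  refine ht δ (lt_min hε (by positivity)) ?_
  have hrow : ∀ i, {j | |β i / α j - t| < δ}.Finite := by
    intro i
    have h0 : Filter.Tendsto (fun j => |β i / α j|) Filter.atTop (nhds 0) := by
      simpa using (hα.const_div_atTop (β i)).abs
    have h1 := h0.eventually (gt_mem_nhds (half_pos htp))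
    rw [← Nat.cofinite_eq_atTop, Filter.eventually_cofinite] at h1
    refine h1.subset fun j hj => ?_
    simp only [Set.mem_ofPred_eq, not_lt] at hj ⊢
    have := abs_sub_abs_le_abs_sub t (β i / α j)
    rw [abs_sub_comm] at this
    linarith
  have hcol : ∀ j, {i | α j ≠ 0 ∧ |β i / α j - t| < δ}.Finite := by
    intro j
    by_cases hj : α j = 0
    · simp [hj]
    have h0 : Filter.Tendsto (fun i => |β i / α j|) Filter.atTop Filter.atTop := by
      simp only [abs_div]
      exact (Filter.tendsto_abs_atTop_atTop.comp hβ).atTop_div_const (abs_pos.2 hj)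
    have h1 := h0.eventually (Filter.eventually_gt_atTop (|t| + δ))
    rw [← Nat.cofinite_eq_atTop, Filter.eventually_cofinite] at h1
    refine h1.subset fun i hi => ?_
    simp only [Set.mem_ofPred_eq, not_lt] at hi ⊢
    have := abs_sub_abs_le_abs_sub (β i / α j) t
    linarith [hi.2]
  refine ((Set.finite_iUnion fun i : Fin N => (Set.finite_singleton (i : ℕ)).prod (hrow i)).union
    (Set.finite_iUnion fun j : Fin N => (hcol j).prod (Set.finite_singleton (j : ℕ)))).subset ?_
  rintro ⟨i, j⟩ ⟨hj0, hij⟩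
  simp only at hj0 hij
  rcases lt_or_ge i N with hi | hi
  · exact Or.inl (Set.mem_iUnion.2 ⟨⟨i, hi⟩, rfl, hij⟩)
  rcases lt_or_ge j N with hj | hj
  · exact Or.inr (Set.mem_iUnion.2 ⟨⟨j, hj⟩, ⟨hj0, hij⟩, rfl⟩)
  · linarith [H i hi j hj]

theorem nonneg_of_mem_finiteLimitPoints
    (hα : Filter.Tendsto α Filter.atTop Filter.atTop)
    (hβ : Filter.Tendsto β Filter.atTop Filter.atTop) {t : ℝ}
    (ht : t ∈ finiteLimitPoints β α) : 0 ≤ t := by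
  by_contra! h
  obtain ⟨N₁, h₁⟩ := Filter.eventually_atTop.1 (hα.eventually_ge_atTop 0)
  obtain ⟨N₂, h₂⟩ := Filter.eventually_atTop.1 (hβ.eventually_ge_atTop 0)
  obtain ⟨i, hi, j, hj, hij⟩ := exists_ge_of_mem_finiteLimitPoints hα hβ ht h.ne
    (neg_pos.2 h) (max N₁ N₂)
  have h3 : 0 ≤ β i / α j :=
    div_nonneg (h₂ i (le_of_max_le_right hi)) (h₁ j (le_of_max_le_left hj))
  linarith [(abs_lt.1 hij).2]

theorem isBounded_finiteLimitPoints_iff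
    (hα : Filter.Tendsto α Filter.atTop Filter.atTop)
    (hβ : Filter.Tendsto β Filter.atTop Filter.atTop) :
    Bornology.IsBounded (finiteLimitPoints β α) ↔ ∃ M, ∀ t ∈ finiteLimitPoints β α, t ≤ M := by
  constructor
  · intro h
    obtain ⟨M, hM⟩ := h.bddAbove
    exact ⟨M, fun t ht => hM ht⟩
  · rintro ⟨M, hM⟩
    exact (Metric.isBounded_Icc 0 M).subset
      fun t ht => ⟨nonneg_of_mem_finiteLimitPoints hα hβ ht, hM t ht⟩

/-- A compact set without finite limit points contains only finitely many quotients. -/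
theorem finite_of_disjoint_finiteLimitPoints {K : Set ℝ} (hK : IsCompact K)
    (h : ∀ t ∈ K, t ∉ finiteLimitPoints β α) :
    {ij : ℕ × ℕ | α ij.2 ≠ 0 ∧ β ij.1 / α ij.2 ∈ K}.Finite := by
  refine hK.induction_on (p := fun s => {ij : ℕ × ℕ | α ij.2 ≠ 0 ∧ β ij.1 / α ij.2 ∈ s}.Finite)
    (by simp) (fun s t hst ht => ht.subset fun ij hij => ⟨hij.1, hst hij.2⟩) ?_ ?_
  · intro s t hs ht
    refine (hs.union ht).subset ?_
    rintro ij ⟨h1, h2 | h2⟩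
    exacts [Or.inl ⟨h1, h2⟩, Or.inr ⟨h1, h2⟩]
  · intro t ht
    have h1 := h t ht
    simp only [finiteLimitPoints, Set.mem_ofPred_eq, not_forall, Set.not_infinite] at h1
    obtain ⟨ε, hε, hfin⟩ := h1
    exact ⟨Metric.ball t ε, mem_nhdsWithin_of_mem_nhds (Metric.ball_mem_nhds t hε), hfin⟩

end LimitPoints

/-! ### Pairs with a source of infinite type -/

section Infinite

variable {𝕜 : Type*} [RCLike 𝕜] {α β s : ℕ → ℝ}

/-- With `M` above all limit points, `β i ≤ M * α j` lets the norm `0` replace the norm `k` at the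
cost `exp ((s k - s 0) * M * α j)`, which is independent of `T`. The other coordinates lie beyond
the gap and contribute a bounded amount. -/
theorem tamePair_infiniteGrading_of_isBounded
    (hα : Filter.Tendsto α Filter.atTop Filter.atTop)
    (hβ : Filter.Tendsto β Filter.atTop Filter.atTop) (hs : StrictMono s)
    (h : Bornology.IsBounded (finiteLimitPoints β α)) :
    TamePair (infiniteGrading 𝕜 α) (weightedGrading 𝕜 s β) := by
  obtain ⟨M', hM'⟩ := (isBounded_finiteLimitPoints_iff hα hβ).1 h
  obtain ⟨M, hM0, hM⟩ : ∃ M, 0 ≤ M ∧ ∀ t ∈ finiteLimitPoints β α, t < M :=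
    ⟨|M'| + 1, by positivity, fun t ht => by linarith [hM' t ht, le_abs_self M']⟩
  have hs0 : ∀ k, 0 ≤ s k - s 0 := fun k => sub_nonneg.2 (hs.monotone (Nat.zero_le k))
  refine (tamePair_iff (essentiallyIncreasing_weightedGrading strictMono_infiniteExp.monotone hα)
    _).2 ⟨fun k => k + ⌈(s k - s 0) * M⌉₊, fun a b hab => add_le_add hab (Nat.ceil_mono
      (mul_le_mul_of_nonneg_right (sub_le_sub_right (hs.monotone hab) _) hM0)), ?_⟩
  intro T hT
  obtain ⟨m, C, hC, hm⟩ := hT 0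
  refine ⟨m, fun k hk => ?_⟩
  obtain ⟨m', C', hC', hm'⟩ := hT (k + 1)
  have hd : 0 < s (k + 1) - s k := sub_pos.2 (hs (Nat.lt_succ_self k))
  -- Beyond `N * α j`, passing from `s k` to `s (k + 1)` gains enough to cancel the growth `exp
  -- (infiniteExp m' * α j)` of the norm `k + 1`.
  set N : ℝ := infiniteExp m' / (s (k + 1) - s k) with hN
  have hfin := finite_of_disjoint_finiteLimitPoints (K := Set.Icc M N) isCompact_Icc
    (fun t ht ht' => absurd (hM t ht') (not_lt.2 ht.1))
  have hev : ∀ᶠ j in Filter.atTop, ∀ i, ¬ (α j ≠ 0 ∧ β i / α j ∈ Set.Icc M N) := by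
    have h1 := hfin.image Prod.snd
    rw [← Nat.cofinite_eq_atTop]
    filter_upwards [h1.compl_mem_cofinite] with j hj i hij
    exact hj ⟨(i, j), hij, rfl⟩
  refine hT.exists_bound_of_eventually (C := C + C') ?_
  filter_upwards [hev, hα.eventually_gt_atTop 0] with j hj hj0
  set y := T (unitVector infiniteExp α j) with hy
  have h0 := hm (unitVector infiniteExp α j)
  have h1 := hm' (unitVector infiniteExp α j)
  rw [weightedGrading_unitVector] at h0 h1
  have hpt : ∀ i, ‖y.1 i‖ * Real.exp (s k * β i) ≤
      Real.exp ((s k - s 0) * M * α j) * (‖y.1 i‖ * Real.exp (s 0 * β i)) +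
      Real.exp (-(infiniteExp m' * α j)) * (‖y.1 i‖ * Real.exp (s (k + 1) * β i)) := by
    intro i
    have key : Real.exp (s k * β i) ≤ Real.exp ((s k - s 0) * M * α j) * Real.exp (s 0 * β i) +
        Real.exp (-(infiniteExp m' * α j)) * Real.exp (s (k + 1) * β i) := by
      rw [← Real.exp_add, ← Real.exp_add]
      rcases le_or_gt (β i) (M * α j) with hi | hi
      · refine le_add_of_le_of_nonneg (Real.exp_le_exp.2 ?_) (Real.exp_pos _).le
        nlinarith [hs0 k]
      · refine le_add_of_nonneg_of_le (Real.exp_pos _).le (Real.exp_le_exp.2 ?_)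
        have hi2 : N * α j < β i := by
          by_contra! hi2
          exact hj i ⟨hj0.ne', ((le_div_iff₀ hj0).2 hi.le), (div_le_iff₀ hj0).2 hi2⟩
        have h3 : (s (k + 1) - s k) * N = infiniteExp m' := mul_div_cancel₀ _ hd.ne'
        have h4 := mul_lt_mul_of_pos_left hi2 hd
        rw [← mul_assoc, h3] at h4
        linarith
    have := mul_le_mul_of_nonneg_left key (norm_nonneg (y.1 i))
    linarith
  have hsum := Summable.tsum_le_tsum hpt (y.2 k)
    (((y.2 0).mul_left _).add ((y.2 (k + 1)).mul_left _))
  rw [((y.2 0).mul_left _).tsum_add ((y.2 (k + 1)).mul_left _), tsum_mul_left, tsum_mul_left]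
    at hsum
  simp only [← weightedGrading_apply] at hsum
  refine hsum.trans ?_
  rw [add_mul]
  refine add_le_add ?_ ?_
  · refine (mul_le_mul_of_nonneg_left h0 (Real.exp_pos _).le).trans ?_
    rw [mul_left_comm, ← Real.exp_add]
    refine mul_le_mul_of_nonneg_left (Real.exp_le_exp.2 ?_) hC.le
    rw [← add_mul]
    refine mul_le_mul_of_nonneg_right ?_ hj0.le
    have h5 := Nat.le_ceil ((s k - s 0) * M)
    have h6 : (m : ℝ) ≤ k := by exact_mod_cast hk
    simp only [infiniteExp]
    push_cast
    linarith
  · refine (mul_le_mul_of_nonneg_left h1 (Real.exp_pos _).le).trans ?_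
    rw [mul_left_comm, ← Real.exp_add, neg_add_cancel, Real.exp_zero]
    refine mul_le_mul_of_nonneg_left (Real.one_le_exp ?_) hC'.le
    simp only [infiniteExp]
    positivity

/-- Weighted partial permutations as continuous operators. -/
theorem exists_isContinuousOp_of_injective {r : ℕ → ℝ} {I J : ℕ → ℕ} (hI : Function.Injective I)
    (hJ : Function.Injective J) (c : ℕ → ℝ)
    (h : ∀ k, ∃ m : ℕ, ∃ C : ℝ, 0 < C ∧
      ∀ l, |c l| * Real.exp (s k * β (I l)) ≤ C * Real.exp (r m * α (J l))) :
    ∃ T : weightedSpace 𝕜 r α →ₗ[𝕜] weightedSpace 𝕜 s β,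
      IsContinuousOp (weightedGrading 𝕜 r α) (weightedGrading 𝕜 s β) T ∧
      ∀ k l, weightedGrading 𝕜 s β k (T (unitVector r α (J l))) =
        |c l| * Real.exp (s k * β (I l)) := by
  set f : (ℕ → 𝕜) → ℕ → 𝕜 := fun x => Function.extend I (fun l => (c l : 𝕜) * x (J l)) 0 with hf
  have hnorm : ∀ x k, (fun n => ‖f x n‖ * Real.exp (s k * β n)) =
      Function.extend I (fun l => ‖x (J l)‖ * (|c l| * Real.exp (s k * β (I l)))) 0 := by
    intro x k
    funext n
    by_cases hn : ∃ l, I l = n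
    · obtain ⟨l, rfl⟩ := hn
      simp only [hf, hI.extend_apply, norm_mul, RCLike.norm_ofReal]
      ring
    · simp [hf, Function.extend_apply' _ _ _ hn]
  have hle : ∀ (x : weightedSpace 𝕜 r α) (k m : ℕ) (C : ℝ),
      (∀ l, |c l| * Real.exp (s k * β (I l)) ≤ C * Real.exp (r m * α (J l))) →
      ∀ l, ‖x.1 (J l)‖ * (|c l| * Real.exp (s k * β (I l))) ≤
        C * (‖x.1 (J l)‖ * Real.exp (r m * α (J l))) := by
    intro x k m C hb l
    have := mul_le_mul_of_nonneg_left (hb l) (norm_nonneg (x.1 (J l)))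
    linarith
  have hsum : ∀ (x : weightedSpace 𝕜 r α) k,
      Summable fun l => ‖x.1 (J l)‖ * (|c l| * Real.exp (s k * β (I l))) := by
    intro x k
    obtain ⟨m, C, hC, hb⟩ := h k
    exact Summable.of_nonneg_of_le (fun l => by positivity) (hle x k m C hb)
      (((x.2 m).comp_injective hJ).mul_left C)
  let T : weightedSpace 𝕜 r α →ₗ[𝕜] weightedSpace 𝕜 s β :=
    { toFun := fun x => ⟨f x.1, fun k => by
        rw [hnorm, summable_extend_zero hI]
        exact hsum x k⟩
      map_add' := by
        intro x y
        ext n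
        change f (x.1 + y.1) n = f x.1 n + f y.1 n
        by_cases hn : ∃ l, I l = n
        · obtain ⟨l, rfl⟩ := hn
          simp only [hf, hI.extend_apply, Pi.add_apply, mul_add]
        · simp [hf, Function.extend_apply' _ _ _ hn]
      map_smul' := by
        intro a x
        ext n
        change f (a • x.1) n = a * f x.1 n
        by_cases hn : ∃ l, I l = n
        · obtain ⟨l, rfl⟩ := hn
          simp only [hf, hI.extend_apply, Pi.smul_apply, smul_eq_mul, mul_left_comm]
        · simp [hf, Function.extend_apply' _ _ _ hn] }
  have hT : ∀ k x, weightedGrading 𝕜 s β k (T x) =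
      ∑' l, ‖x.1 (J l)‖ * (|c l| * Real.exp (s k * β (I l))) := by
    intro k x
    rw [weightedGrading_apply]
    change ∑' n, ‖f x.1 n‖ * Real.exp (s k * β n) = _
    rw [hnorm, tsum_extend_zero hI]
  refine ⟨T, fun k => ?_, fun k l => ?_⟩
  · obtain ⟨m, C, hC, hb⟩ := h k
    refine ⟨m, C, hC, fun x => ?_⟩
    have hcomp := (x.2 m).comp_injective hJ
    rw [hT]
    refine (Summable.tsum_le_tsum (hle x k m C hb) (hsum x k) (hcomp.mul_left C)).trans ?_
    refine (tsum_mul_left (f := fun l => ‖x.1 (J l)‖ * Real.exp (r m * α (J l)))).trans_le ?_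
    exact mul_le_mul_of_nonneg_left
      (tsum_comp_le_tsum_of_inj (x.2 m) (fun n => by positivity) hJ) hC.le
  · rw [hT, tsum_eq_single l]
    · simp [unitVector]
    · intro l' hl'
      simp [unitVector, hJ.ne hl']

/-- A choice of pairs beyond any bound can be made with both components strictly increasing. -/
theorem exists_strictMono_pair {P : ℕ → ℕ → ℕ → Prop}
    (h : ∀ l N, ∃ i ≥ N, ∃ j ≥ N, P l i j) :
    ∃ I J : ℕ → ℕ, StrictMono I ∧ StrictMono J ∧ ∀ l, P l (I l) (J l) := by
  choose I hI J hJ hP using h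
  -- Each threshold exceeds both indices chosen before it.
  let N : ℕ → ℕ := fun l => Nat.rec 0 (fun l n => I l n + J l n + 1) l
  have hN : ∀ l, N (l + 1) = I l (N l) + J l (N l) + 1 := fun _ => rfl
  refine ⟨fun l => I l (N l), fun l => J l (N l), strictMono_nat_of_lt_succ fun l => ?_,
    strictMono_nat_of_lt_succ fun l => ?_, fun l => hP l (N l)⟩
  · have := hI (l + 1) (N (l + 1))
    have := hN l
    omega
  · have := hJ (l + 1) (N (l + 1))
    have := hN l
    omega

/-- A diagonal argument: one operator violates the estimate given by `S` at every level `n`, each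
level being served by infinitely many pairs. Large limit points keep it continuous, since lowering
the level below `n` then costs more than the excess introduced at `n`. -/
theorem isBounded_of_tamePair_infiniteGrading
    (hα : Filter.Tendsto α Filter.atTop Filter.atTop)
    (hβ : Filter.Tendsto β Filter.atTop Filter.atTop) (hs : StrictMono s)
    (h : TamePair (infiniteGrading 𝕜 α) (weightedGrading 𝕜 s β)) :
    Bornology.IsBounded (finiteLimitPoints β α) := by
  rw [isBounded_finiteLimitPoints_iff hα hβ]
  by_contra! hunb
  obtain ⟨S, -, hS⟩ := (tamePair_iff
    (essentiallyIncreasing_weightedGrading strictMono_infiniteExp.monotone hα) _).1 h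
  -- For `n = 0` the denominator is zero and the quotient is `0`; this is harmless, as the bound is
  -- used only for `n > k`.
  choose t ht hR using fun n : ℕ => hunb (|((S n : ℝ) + 2) / (s n - s (n - 1))| + 1)
  have ht1 : ∀ n, 0 < t n - 1 := fun n => by
    linarith [hR n, abs_nonneg (((S n : ℝ) + 2) / (s n - s (n - 1)))]
  obtain ⟨N₀, hN₀⟩ := Filter.eventually_atTop.1 (hα.eventually_gt_atTop 0)
  obtain ⟨I, J, hI, hJ, hIJ⟩ := exists_strictMono_pair (P := fun l i j => 0 < α j ∧
      (t l.unpair.1 - 1) * α j ≤ β i ∧ β i ≤ (t l.unpair.1 + 1) * α j) (by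
    intro l N
    obtain ⟨i, hi, j, hj, hij⟩ := exists_ge_of_mem_finiteLimitPoints hα hβ (ht l.unpair.1)
      (by linarith [ht1 l.unpair.1] : 0 < t l.unpair.1).ne' one_pos (max N N₀)
    have hj0 := hN₀ j (le_of_max_le_right hj)
    obtain ⟨h1, h2⟩ := abs_lt.1 hij
    exact ⟨i, le_of_max_le_left hi, j, le_of_max_le_left hj, hj0,
      (le_div_iff₀ hj0).1 (by linarith), (div_le_iff₀ hj0).1 (by linarith)⟩)
  obtain ⟨T, hTc, hT⟩ := exists_isContinuousOp_of_injective (𝕜 := 𝕜) (s := s) (r := infiniteExp)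
    (α := α) (β := β) hI.injective hJ.injective
    -- At level `n` the image norm is `exp ((S n + 2) * α (J l))`, against `exp ((S n + 1) * α (J
    -- l))` for the source norm `S n`.
    (fun l => Real.exp (-(s l.unpair.1) * β (I l) + (S l.unpair.1 + 2) * α (J l))) (by
    intro k
    -- Only the finitely many levels `n ≤ k` require growth; for `n > k` the image norms are at most
    -- `1`.
    refine ⟨∑ n ∈ Finset.range (k + 1), ⌈(s k - s n) * (t n + 1) + (S n + 2)⌉₊, 1, one_pos,
      fun l => ?_⟩
    obtain ⟨h0, h1, h2⟩ := hIJ l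
    rw [abs_of_pos (Real.exp_pos _), ← Real.exp_add, one_mul]
    refine Real.exp_le_exp.2 ?_
    set n := l.unpair.1
    simp only [infiniteExp]
    rcases lt_or_ge k n with hkn | hkn
    · refine le_trans ?_ (mul_nonneg (by positivity) h0.le)
      have hd : 0 < s n - s (n - 1) := sub_pos.2 (hs (by omega))
      have hd' : s k ≤ s (n - 1) := hs.monotone (by omega)
      have h3 : ((S n : ℝ) + 2) / (s n - s (n - 1)) ≤ t n - 1 := by
        linarith [hR n, le_abs_self (((S n : ℝ) + 2) / (s n - s (n - 1)))]
      have h4 : (S n : ℝ) + 2 ≤ (s n - s k) * (t n - 1) := by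
        rw [div_le_iff₀ hd] at h3
        nlinarith [ht1 n]
      have h5 := mul_le_mul_of_nonneg_right h4 h0.le
      have h6 := mul_le_mul_of_nonneg_left h1 (by linarith : 0 ≤ s n - s k)
      linarith
    · have h3 : (s k - s n) * (t n + 1) + (S n + 2) ≤
          ((∑ n ∈ Finset.range (k + 1), ⌈(s k - s n) * (t n + 1) + (S n + 2)⌉₊ : ℕ) : ℝ) := by
        refine (Nat.le_ceil _).trans ?_
        exact_mod_cast Finset.single_le_sum
          (f := fun n => ⌈(s k - s n) * (t n + 1) + ((S n : ℝ) + 2)⌉₊)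
          (fun i _ => Nat.zero_le _) (Finset.mem_range.2 (Nat.lt_succ_of_le hkn))
      have h4 := mul_le_mul_of_nonneg_right h3 h0.le
      have h5 := mul_le_mul_of_nonneg_left h2 (sub_nonneg.2 (hs.monotone hkn))
      linarith)
  obtain ⟨k, hk⟩ := hS T hTc
  obtain ⟨C, hC, hb⟩ := hk k le_rfl
  obtain ⟨N, hN⟩ := Filter.eventually_atTop.1 (hα.eventually_gt_atTop (Real.log C))
  -- Among the pairs serving level `k`, this one is so far out that the surplus factor `exp (α (J
  -- l))` exceeds `C`.
  have h1 := hb (unitVector infiniteExp α (J (Nat.pair k N)))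
  rw [hT, weightedGrading_unitVector, abs_of_pos (Real.exp_pos _), ← Real.exp_add,
    Nat.unpair_pair] at h1
  have h2 := hN (J (Nat.pair k N)) ((Nat.right_le_pair k N).trans (hJ.le_apply))
  refine absurd h1 (not_le.2 ?_)
  rw [← Real.exp_log hC, ← Real.exp_add]
  refine Real.exp_lt_exp.2 ?_
  simp only [infiniteExp]
  linarith

theorem tamePair_infiniteGrading_iff
    (hα : Filter.Tendsto α Filter.atTop Filter.atTop)
    (hβ : Filter.Tendsto β Filter.atTop Filter.atTop) (hs : StrictMono s) :
    TamePair (infiniteGrading 𝕜 α) (weightedGrading 𝕜 s β) ↔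
      Bornology.IsBounded (finiteLimitPoints β α) :=
  ⟨isBounded_of_tamePair_infiniteGrading hα hβ hs, tamePair_infiniteGrading_of_isBounded hα hβ hs⟩

end Infinite

end PowerSeries10

theorem mainTheorem10 (𝕜 : Type*) [RCLike 𝕜] (α β : ℕ → ℝ)
    (hα : Monotone α) (hα' : Filter.Tendsto α Filter.atTop Filter.atTop)
    (hβ : Monotone β) (hβ' : Filter.Tendsto β Filter.atTop Filter.atTop) :
    PowerSeries10.IsTame (PowerSeries10.prodGrading
      (PowerSeries10.finiteGrading 𝕜 α) (PowerSeries10.finiteGrading 𝕜 β)) ∧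
    (PowerSeries10.IsTame (PowerSeries10.prodGrading
      (PowerSeries10.finiteGrading 𝕜 α) (PowerSeries10.infiniteGrading 𝕜 β)) ↔
        Bornology.IsBounded (PowerSeries10.finiteLimitPoints β β) ∧
        Bornology.IsBounded (PowerSeries10.finiteLimitPoints α β)) ∧
    (PowerSeries10.IsTame (PowerSeries10.prodGrading
      (PowerSeries10.infiniteGrading 𝕜 α) (PowerSeries10.infiniteGrading 𝕜 β)) ↔
        Bornology.IsBounded (PowerSeries10.finiteLimitPoints β β) ∧
        Bornology.IsBounded (PowerSeries10.finiteLimitPoints α α) ∧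
        Bornology.IsBounded (PowerSeries10.finiteLimitPoints β α) ∧
        Bornology.IsBounded (PowerSeries10.finiteLimitPoints α β)) := by
  have hα₀ := PowerSeries10.essentiallyIncreasing_weightedGrading (𝕜 := 𝕜)
    PowerSeries10.strictMono_finiteExp.monotone hα'
  have hβ₀ := PowerSeries10.essentiallyIncreasing_weightedGrading (𝕜 := 𝕜)
    PowerSeries10.strictMono_finiteExp.monotone hβ'
  have hα₁ := PowerSeries10.essentiallyIncreasing_weightedGrading (𝕜 := 𝕜)
    PowerSeries10.strictMono_infiniteExp.monotone hα'
  have hβ₁ := PowerSeries10.essentiallyIncreasing_weightedGrading (𝕜 := 𝕜)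
    PowerSeries10.strictMono_infiniteExp.monotone hβ'
  have hfin := PowerSeries10.strictMono_finiteExp
  have hinf := PowerSeries10.strictMono_infiniteExp
  refine ⟨?_, ?_, ?_⟩
  · exact (PowerSeries10.isTame_prodGrading_iff hα₀ hβ₀).2
      ⟨PowerSeries10.tamePair_finiteGrading α hα' hfin,
        PowerSeries10.tamePair_finiteGrading β hα' hfin,
        PowerSeries10.tamePair_finiteGrading α hβ' hfin,
        PowerSeries10.tamePair_finiteGrading β hβ' hfin⟩
  · rw [PowerSeries10.isTame_prodGrading_iff hα₀ hβ₁,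
      PowerSeries10.tamePair_infiniteGrading_iff hβ' hα' hfin,
      PowerSeries10.tamePair_infiniteGrading_iff hβ' hβ' hinf]
    exact ⟨fun h => ⟨h.2.2.2, h.2.2.1⟩,
      fun h => ⟨PowerSeries10.tamePair_finiteGrading α hα' hfin,
        PowerSeries10.tamePair_finiteGrading β hα' hinf, h.2, h.1⟩⟩
  · rw [PowerSeries10.isTame_prodGrading_iff hα₁ hβ₁,
      PowerSeries10.tamePair_infiniteGrading_iff hα' hα' hinf,
      PowerSeries10.tamePair_infiniteGrading_iff hα' hβ' hinf,
      PowerSeries10.tamePair_infiniteGrading_iff hβ' hα' hinf,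
      PowerSeries10.tamePair_infiniteGrading_iff hβ' hβ' hinf]
    tauto
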